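/- Let $n = 2k+1 \ge 7$ be an odd integer. The flower snark $J_n$ is the graph on the $4n$ vertices $a_i, b_i, c_i, d_i$ ($1 \le i \le n$) whose edges are $b_ia_i,\ b_ic_i,\ b_id_i$ for $1 \le i \le n$, the edges of the cycle $a_1a_2\cdots a_na_1$, and the edges of the cycle $c_1c_2\cdots c_nd_1d_2\cdots d_nc_1$. For a nonempty vertex set $S$ and a nonempty vertex set $X$ of a graph $G$, the distance array of $X$ with respect to $S$ is $\mathcal{D}_S(X) = (d(s,X))_{s\in S}$, where $d(s,X) = \min_{x\in X} d(s,x)$. The set $S$ is a $\{2\}$-resolving set of $G$ if $\mathcal{D}_S(X) \ne \mathcal{D}_S(Y)$ for all distinct nonempty vertex sets $X, Y$ of $G$ with $|X| \le 2$ and $|Y| \le 2$; the $\{2\}$-metric dimension $\beta_2(G)$ is the minimum cardinality of a $\{2\}$-resolving set of $G$. Then the set $$S = \{a_1, c_1, d_1, a_2, a_{k+1}, a_{k+2}, c_{k+2}, d_{k+2}\}$$ is a $\{2\}$-resolving set of $J_n$ with exactly eight elements. In particular, $\beta_2(J_n) \le 8$. -/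

import Mathlib

/-- The distance array `(d(s, X))_{s ∈ S}` of a vertex set `X` with respect to `S`, where
`d(s, X) = min_{x ∈ X} d(s, x)`. Distances are extended natural numbers, so that two vertices in
different components are at distance `⊤`. -/
noncomputable def distArray {V : Type*} (G : SimpleGraph V) (S X : Finset V) : S → ℕ∞ :=
  fun s => X.inf (fun x => G.edist (s : V) x)

/-- The (nonempty) set `S` is an `{ℓ}`-resolving set of `G`: any two distinct nonempty vertex sets
with at most `ℓ` elements have different distance arrays with respect to `S`. -/
def IsResolvingSet {V : Type*} (G : SimpleGraph V) (ℓ : ℕ) (S : Finset V) : Prop :=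
  S.Nonempty ∧ ∀ X Y : Finset V, X.Nonempty → Y.Nonempty → X.card ≤ ℓ → Y.card ≤ ℓ → X ≠ Y →
    distArray G S X ≠ distArray G S Y

/-- The `{ℓ}`-metric dimension `β_ℓ(G)` of `G`: the minimum cardinality of an `{ℓ}`-resolving set
of `G` (`⊤` if there is no finite one). -/
noncomputable def metricDim {V : Type*} (G : SimpleGraph V) (ℓ : ℕ) : ℕ∞ :=
  ⨅ (S : Finset V) (_ : IsResolvingSet G ℓ S), (S.card : ℕ∞)

/-- The four types of vertices of a flower snark. -/
inductive SnarkKind : Type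
  | a | b | c | d
  deriving DecidableEq

/-- The vertices of the flower snark `J_n`. The pair `(t, i)` with `i ∈ {0, …, n - 1}` is the vertex
`t_{i+1}`; for example `(.a, 0)` is `a_1`. -/
abbrev SnarkVertex (n : ℕ) : Type := SnarkKind × Fin n

/-- The edges of the flower snark, each listed in one direction: the stars with centre `b_i` and
leaves `a_i`, `c_i`, `d_i`; the cycle `a_1 a_2 … a_n a_1`; and the cycle
`c_1 c_2 … c_n d_1 d_2 … d_n c_1`. -/
inductive SnarkEdge (n : ℕ) : SnarkVertex n → SnarkVertex n → Prop
  | ba (i : Fin n) : SnarkEdge n (.b, i) (.a, i)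
  | bc (i : Fin n) : SnarkEdge n (.b, i) (.c, i)
  | bd (i : Fin n) : SnarkEdge n (.b, i) (.d, i)
  | aa (i j : Fin n) (h : i.val + 1 = j.val) : SnarkEdge n (.a, i) (.a, j)
  | aa' (i j : Fin n) (hi : i.val + 1 = n) (hj : j.val = 0) : SnarkEdge n (.a, i) (.a, j)
  | cc (i j : Fin n) (h : i.val + 1 = j.val) : SnarkEdge n (.c, i) (.c, j)
  | dd (i j : Fin n) (h : i.val + 1 = j.val) : SnarkEdge n (.d, i) (.d, j)
  | cd (i j : Fin n) (hi : i.val + 1 = n) (hj : j.val = 0) : SnarkEdge n (.c, i) (.d, j)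
  | dc (i j : Fin n) (hi : i.val + 1 = n) (hj : j.val = 0) : SnarkEdge n (.d, i) (.c, j)

/-- The flower snark `J_n` (used for odd `n ≥ 5`). -/
def flowerSnark (n : ℕ) : SimpleGraph (SnarkVertex n) :=
  SimpleGraph.fromRel (SnarkEdge n)

/-- The vertex set `{a_1, c_1, d_1, a_2, a_{k+1}, a_{k+2}, c_{k+2}, d_{k+2}}` of `J_n`, `n = 2k + 1`
(the `Fin n` index of `t_i` is `i - 1`). -/
def snarkSet (n k : ℕ) (hk : n = 2 * k + 1) (hn : 7 ≤ n) : Finset (SnarkVertex n) :=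
  {(.a, ⟨0, by omega⟩), (.c, ⟨0, by omega⟩), (.d, ⟨0, by omega⟩), (.a, ⟨1, by omega⟩),
    (.a, ⟨k, by omega⟩), (.a, ⟨k + 1, by omega⟩), (.c, ⟨k + 1, by omega⟩), (.d, ⟨k + 1, by omega⟩)}

/-! The set consists of the three leaves in each of the two reference columns `1` and `k + 2`, plus
the probes `a_2` and `a_{k+1}`. A reference column sees a vertex as a kind and a column distance `u
≤ k`, with `c` and `d` named along the shorter way. Its three leaves resolve single vertices. A pair
yields the minimum of two profiles: if neither profile dominates the other, both views are
recovered; otherwise only the dominating one is (`SameRays.matches`). Each view leaves a two-fold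
ambiguity, namely reflection in its reference column, but the two views together determine a vertex.
The leaves thus give two matchings between the pairs `X` and `Y`, one per column. They may disagree
on the order or hide a dominated vertex. The probes lie on the same side of both reference columns,
so they separate reflected twins and exclude every disagreement (`eq_and_eq_of_matches`,
`eq_or_eq_of_cross`, `eq_or_eq_of_opposite`). The distances in `J_n` come from explicit formulas
checked by `edist_eq_of_descent`. -/

/-! ### Pairs of vertices seen from one reference column -/

namespace SnarkKind

/-- The distance from the leaf of kind `e` in a reference column to a vertex of kind `t` at
column distance `u`, where `c` and `d` are labelled along the shorter way. -/
def ray (k : ℕ) : SnarkKind → SnarkKind → ℕ → ℕ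
  | .a, .a, u => u
  | .a, .b, u => u + 1
  | .a, _, u => u + 2
  | .b, _, u => u
  | .c, .a, u => u + 2
  | .c, .b, u => u + 1
  | .c, .c, u => u
  -- Either change strand through a star, or go the other way round and use the twist. For `u ≤ k`
  -- the second is shorter only at `u = k`.
  | .c, .d, u => min (u + 2) (2 * k + 1 - u)
  | .d, .a, u => u + 2
  | .d, .b, u => u + 1
  | .d, .c, u => min (u + 2) (2 * k + 1 - u)
  | .d, .d, u => u

/-- The vertex `q` is at least as far as `p` from the three leaves of the reference column. -/
def Dominates (k : ℕ) (p q : SnarkKind × ℕ) : Prop :=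
  ray k .a p.1 p.2 ≤ ray k .a q.1 q.2 ∧ ray k .c p.1 p.2 ≤ ray k .c q.1 q.2 ∧
    ray k .d p.1 p.2 ≤ ray k .d q.1 q.2

/-- The pairs of vertices neither of which dominates the other, up to order. -/
def BothVisible : SnarkKind × ℕ → SnarkKind × ℕ → Prop
  | (.a, u), (.b, v) => u = v
  | (.a, u), (.c, v) => u ≤ v + 1 ∧ v ≤ u + 1
  | (.a, u), (.d, v) => u ≤ v + 1 ∧ v ≤ u + 1
  | (.b, u), (.c, v) => u = v
  | (.b, u), (.d, v) => u = v
  | (.c, u), (.d, v) => u ≤ v + 1 ∧ v ≤ u + 1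
  | _, _ => False

/-- The pairs `{p₁, p₂}` and `{q₁, q₂}` have the same distances from the leaves of the reference
column. -/
def SameRays (k : ℕ) (p₁ p₂ q₁ q₂ : SnarkKind × ℕ) : Prop :=
  ∀ e, e ≠ .b → min (ray k e p₁.1 p₁.2) (ray k e p₂.1 p₂.2) =
    min (ray k e q₁.1 q₁.2) (ray k e q₂.1 q₂.2)

/-- The first vertices agree, and the second ones agree or are both dominated. -/
def Matches (k : ℕ) (p₁ p₂ q₁ q₂ : SnarkKind × ℕ) : Prop :=
  p₁ = q₁ ∧ (p₂ = q₂ ∨ (Dominates k p₁ p₂ ∧ Dominates k q₁ q₂))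

theorem dominates_or_bothVisible {k : ℕ} {p q : SnarkKind × ℕ} (hp : p.2 ≤ k) (hq : q.2 ≤ k) :
    Dominates k p q ∨ Dominates k q p ∨ BothVisible p q ∨ BothVisible q p := by
  obtain ⟨t, u⟩ := p
  obtain ⟨s, v⟩ := q
  cases t <;> cases s <;> simp only [Dominates, BothVisible, ray] at * <;> omega

theorem SameRays.symm {k : ℕ} {p₁ p₂ q₁ q₂ : SnarkKind × ℕ} (h : SameRays k p₁ p₂ q₁ q₂) :
    SameRays k q₁ q₂ p₁ p₂ := fun e he => (h e he).symm

theorem SameRays.swap_left {k : ℕ} {p₁ p₂ q₁ q₂ : SnarkKind × ℕ} (h : SameRays k p₁ p₂ q₁ q₂) :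
    SameRays k p₂ p₁ q₁ q₂ := fun e he => by rw [min_comm, h e he]

theorem SameRays.swap_right {k : ℕ} {p₁ p₂ q₁ q₂ : SnarkKind × ℕ} (h : SameRays k p₁ p₂ q₁ q₂) :
    SameRays k p₁ p₂ q₂ q₁ := fun e he => by rw [h e he, min_comm]

theorem Dominates.min_eq {k : ℕ} {p q : SnarkKind × ℕ} (h : Dominates k p q) (e : SnarkKind)
    (he : e ≠ .b) : min (ray k e p.1 p.2) (ray k e q.1 q.2) = ray k e p.1 p.2 := by
  cases e
  exacts [min_eq_left h.1, absurd rfl he, min_eq_left h.2.1, min_eq_left h.2.2]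

/-- The unique nearest leaf reveals the kind; a three-way tie means `b`. -/
theorem eq_of_ray_eq {k : ℕ} {p q : SnarkKind × ℕ} (hp : p.2 ≤ k) (hq : q.2 ≤ k)
    (h : ∀ e, e ≠ .b → ray k e p.1 p.2 = ray k e q.1 q.2) : p = q := by
  obtain ⟨t, u⟩ := p
  obtain ⟨s, v⟩ := q
  have ha := h .a (by decide)
  have hc := h .c (by decide)
  have hd := h .d (by decide)
  cases t <;> cases s <;> simp only [ray, Prod.mk.injEq, reduceCtorEq, true_and, false_and] at * <;>
    omega

/-- The near miss is a `c` at distance `k`, with rays `k + 2, k, k + 1`: to imitate it, a `c`–`d`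
pair would need its `d` at distance `k + 1`. -/
theorem BothVisible.ray_ne {k : ℕ} {p q₁ q₂ : SnarkKind × ℕ} (hp : p.2 ≤ k) (hq₁ : q₁.2 ≤ k)
    (hq₂ : q₂.2 ≤ k) (hv : BothVisible q₁ q₂)
    (h : ∀ e, e ≠ .b → ray k e p.1 p.2 = min (ray k e q₁.1 q₁.2) (ray k e q₂.1 q₂.2)) :
    False := by
  obtain ⟨t, u⟩ := p
  obtain ⟨s₁, v₁⟩ := q₁
  obtain ⟨s₂, v₂⟩ := q₂
  have ha := h .a (by decide)
  have hc := h .c (by decide)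
  have hd := h .d (by decide)
  clear h
  cases s₁ <;> cases s₂ <;> simp only [BothVisible] at hv <;>
    cases t <;> simp only [ray] at * <;> omega

set_option maxHeartbeats 1000000 in
theorem BothVisible.eq {k : ℕ} {p₁ p₂ q₁ q₂ : SnarkKind × ℕ} (hp₁ : p₁.2 ≤ k) (hp₂ : p₂.2 ≤ k)
    (hq₁ : q₁.2 ≤ k) (hq₂ : q₂.2 ≤ k) (hp : BothVisible p₁ p₂) (hq : BothVisible q₁ q₂)
    (h : SameRays k p₁ p₂ q₁ q₂) : p₁ = q₁ ∧ p₂ = q₂ := by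
  obtain ⟨t₁, u₁⟩ := p₁
  obtain ⟨t₂, u₂⟩ := p₂
  obtain ⟨s₁, v₁⟩ := q₁
  obtain ⟨s₂, v₂⟩ := q₂
  have ha := h .a (by decide)
  have hc := h .c (by decide)
  have hd := h .d (by decide)
  clear h
  cases t₁ <;> cases t₂ <;> simp only [BothVisible] at hp <;>
    cases s₁ <;> cases s₂ <;> simp only [BothVisible] at hq <;>
    simp only [ray, Prod.mk.injEq, reduceCtorEq, true_and, false_and, and_false] at * <;>
    omega

theorem SameRays.matches {k : ℕ} {p₁ p₂ q₁ q₂ : SnarkKind × ℕ} (hp₁ : p₁.2 ≤ k) (hp₂ : p₂.2 ≤ k)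
    (hq₁ : q₁.2 ≤ k) (hq₂ : q₂.2 ≤ k) (h : SameRays k p₁ p₂ q₁ q₂) :
    Matches k p₁ p₂ q₁ q₂ ∨ Matches k p₁ p₂ q₂ q₁ ∨ Matches k p₂ p₁ q₁ q₂ ∨
      Matches k p₂ p₁ q₂ q₁ := by
  have dom : ∀ {p₁ p₂ q₁ q₂ : SnarkKind × ℕ}, p₁.2 ≤ k → q₁.2 ≤ k → SameRays k p₁ p₂ q₁ q₂ →
      Dominates k p₁ p₂ → Dominates k q₁ q₂ → Matches k p₁ p₂ q₁ q₂ :=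
    fun hp hq h h₁ h₂ => ⟨eq_of_ray_eq hp hq fun e he => by
      rw [← h₁.min_eq e he, h e he, h₂.min_eq e he], .inr ⟨h₁, h₂⟩⟩
  have mix : ∀ {p₁ p₂ q₁ q₂ : SnarkKind × ℕ}, p₁.2 ≤ k → q₁.2 ≤ k → q₂.2 ≤ k →
      SameRays k p₁ p₂ q₁ q₂ → Dominates k p₁ p₂ → BothVisible q₁ q₂ → False :=
    fun hp hq hq' h h₁ h₂ => h₂.ray_ne hp hq hq' fun e he => by rw [← h₁.min_eq e he, h e he]
  have vis : ∀ {p₁ p₂ q₁ q₂ : SnarkKind × ℕ}, p₁.2 ≤ k → p₂.2 ≤ k → q₁.2 ≤ k → q₂.2 ≤ k →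
      SameRays k p₁ p₂ q₁ q₂ → BothVisible p₁ p₂ → BothVisible q₁ q₂ → Matches k p₁ p₂ q₁ q₂ :=
    fun a b c d h h₁ h₂ =>
      have := h₁.eq a b c d h₂ h
      ⟨this.1, .inl this.2⟩
  rcases dominates_or_bothVisible hp₁ hp₂ with hp | hp | hp | hp <;>
    rcases dominates_or_bothVisible hq₁ hq₂ with hq | hq | hq | hq
  · exact .inl (dom hp₁ hq₁ h hp hq)
  · exact .inr (.inl (dom hp₁ hq₂ h.swap_right hp hq))
  · exact (mix hp₁ hq₁ hq₂ h hp hq).elim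
  · exact (mix hp₁ hq₂ hq₁ h.swap_right hp hq).elim
  · exact .inr (.inr (.inl (dom hp₂ hq₁ h.swap_left hp hq)))
  · exact .inr (.inr (.inr (dom hp₂ hq₂ h.swap_left.swap_right hp hq)))
  · exact (mix hp₂ hq₁ hq₂ h.swap_left hp hq).elim
  · exact (mix hp₂ hq₂ hq₁ h.swap_left.swap_right hp hq).elim
  · exact (mix hq₁ hp₁ hp₂ h.symm hq hp).elim
  · exact (mix hq₂ hp₁ hp₂ h.swap_right.symm hq hp).elim
  · exact .inl (vis hp₁ hp₂ hq₁ hq₂ h hp hq)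
  · exact .inr (.inl (vis hp₁ hp₂ hq₂ hq₁ h.swap_right hp hq))
  · exact (mix hq₁ hp₂ hp₁ h.swap_left.symm hq hp).elim
  · exact (mix hq₂ hp₂ hp₁ h.swap_left.swap_right.symm hq hp).elim
  · exact .inr (.inr (.inl (vis hp₂ hp₁ hq₁ hq₂ h.swap_left hp hq)))
  · exact .inr (.inr (.inr (vis hp₂ hp₁ hq₂ hq₁ h.swap_left.swap_right hp hq)))
end SnarkKind

/-! ### Locations relative to both reference columns -/

namespace SnarkKind

/-- The exchange of the kinds `c` and `d`. -/
def swapCD : SnarkKind → SnarkKind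
  | .c => .d
  | .d => .c
  | t => t

/-- The distance of a vertex from the leaf `a` of its own column. -/
def height : SnarkKind → ℕ
  | .a => 0
  | .b => 1
  | _ => 2

end SnarkKind

/-- The location of a vertex of `J_n` relative to the columns `1` and `k + 2`: whether its column is
one of `2, …, k + 1`, and its column distances `u` and `v` from those two columns. -/
@[ext] structure SnarkLoc : Type where
  kind : SnarkKind
  inner : Bool
  u : ℕ
  v : ℕ

namespace SnarkLoc
open SnarkKind

/-- The locations that occur in `J_n` with `n = 2 * k + 1`. -/
def Valid (k : ℕ) (x : SnarkLoc) : Prop :=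
  (x.inner = true ∧ x.u + x.v = k + 1 ∧ 1 ≤ x.u ∧ 1 ≤ x.v) ∨ (x.inner = false ∧ x.u + x.v = k)

/-- The kind and distance seen from the first column. -/
def fst (x : SnarkLoc) : SnarkKind × ℕ :=
  (if x.inner then x.kind else x.kind.swapCD, x.u)

/-- The kind and distance seen from column `k + 2`. -/
def snd (x : SnarkLoc) : SnarkKind × ℕ := (x.kind, x.v)

/-- The distance from `a_2`. -/
def dist₂ (k : ℕ) (x : SnarkLoc) : ℕ :=
  -- The cap `k` acts only at `u = k`, where the way through the inner columns is shorter.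
  (if x.inner then x.u - 1 else min (x.u + 1) k) + x.kind.height

/-- The distance from `a_{k+1}`. -/
def dist₃ (k : ℕ) (x : SnarkLoc) : ℕ :=
  (if x.inner then x.v - 1 else min (x.v + 1) k) + x.kind.height

theorem Valid.u_le {k : ℕ} {x : SnarkLoc} (h : x.Valid k) : x.u ≤ k := by
  unfold Valid at h; omega

theorem Valid.v_le {k : ℕ} {x : SnarkLoc} (h : x.Valid k) : x.v ≤ k := by
  unfold Valid at h; omega

/-- The sum `u + v` is `k + 1` inside and `k` outside, so it tells the side. -/
theorem eq_of_fst_snd {k : ℕ} {x y : SnarkLoc} (hx : x.Valid k) (hy : y.Valid k)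
    (h₁ : x.fst = y.fst) (h₂ : x.snd = y.snd) : x = y := by
  simp only [fst, snd, Prod.mk.injEq, Valid] at *
  refine SnarkLoc.ext h₂.1 ?_ h₁.2 h₂.2
  cases hb : x.inner <;> cases hc : y.inner <;> simp [hb, hc] at * <;> omega

theorem eq_or_inner_ne_of_fst {k : ℕ} {x y : SnarkLoc} (hx : x.Valid k) (hy : y.Valid k)
    (h : x.fst = y.fst) : x = y ∨ (y.inner = !x.inner ∧ y.kind = x.kind.swapCD ∧ y.u = x.u) := by
  obtain ⟨t, a, u, v⟩ := x
  obtain ⟨s, b, w, z⟩ := y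
  cases a <;> cases b <;> cases t <;> cases s <;>
    simp [fst, swapCD, Valid] at * <;> omega

theorem eq_or_inner_ne_of_snd {k : ℕ} {x y : SnarkLoc} (hx : x.Valid k) (hy : y.Valid k)
    (h : x.snd = y.snd) : x = y ∨ (y.inner = !x.inner ∧ y.kind = x.kind ∧ y.v = x.v) := by
  obtain ⟨t, a, u, v⟩ := x
  obtain ⟨s, b, w, z⟩ := y
  cases a <;> cases b <;> simp [snd, Valid] at * <;> grind

set_option maxHeartbeats 1000000 in
/-- A vertex that is dominated by another one seen from both columns lies in a longer interval
and is closer to `a_2` and `a_{k+1}`. -/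
theorem eq_or_of_dominates {k : ℕ} {x y : SnarkLoc} (hx : x.Valid k) (hy : y.Valid k)
    (h₁ : Dominates k x.fst y.fst) (h₂ : Dominates k x.snd y.snd) :
    y = x ∨ (x.inner = false ∧ y.inner = true ∧ y.kind = x.kind ∧ x.u ≤ y.u ∧ x.v ≤ y.v) := by
  obtain ⟨t, a, u, v⟩ := x
  obtain ⟨s, b, w, z⟩ := y
  cases a <;> cases b <;> cases t <;> cases s <;>
    simp [fst, snd, swapCD, Valid, Dominates, ray] at * <;> omega

end SnarkLoc

/-! ### Excluding disagreement between the two views -/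

namespace SnarkLoc
open SnarkKind

theorem height_swapCD (t : SnarkKind) : t.swapCD.height = t.height := by cases t <;> rfl

theorem false_of_fst_of_dominates {k : ℕ} {x y z : SnarkLoc} (hx : x.Valid k) (hy : y.Valid k)
    (hz : z.Valid k) (h : x.inner = true) (h₃ : y.inner = !x.inner)
    (h₄ : y.kind = x.kind.swapCD) (h₅ : y.u = x.u) (h₂ : Dominates k z.snd y.snd)
    (e₂ : min (z.dist₂ k) (x.dist₂ k) = min (z.dist₂ k) (y.dist₂ k))
    (e₃ : min (z.dist₃ k) (x.dist₃ k) = min (z.dist₃ k) (y.dist₃ k)) : False := by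
  obtain ⟨t, a, u, v⟩ := x
  obtain ⟨s, b, w, r⟩ := y
  obtain ⟨q, c, m, p⟩ := z
  simp only at h h₃ h₄ h₅
  subst h h₃ h₄ h₅
  simp only [dist₂, dist₃, height_swapCD, Valid, Bool.not_true, Bool.false_eq_true, if_true,
    if_false, false_and, true_and, or_false, false_or, reduceCtorEq] at *
  -- The inner twin `x` is strictly nearer to both probes than `y`, so equal minima force `z` to be
  -- at least as near as `x`. Dominance from column `k + 2` then makes the column distances of `z`
  -- too small in total.
  have i₂ : (if c then m - 1 else min (m + 1) k) + q.height ≤ w - 1 + t.height := by omega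
  have i₃ : (if c then p - 1 else min (p + 1) k) + q.height ≤ r + t.height := by omega
  clear e₂ e₃
  cases c <;> cases t <;> cases q <;>
    simp [snd, swapCD, Dominates, ray, height] at * <;> omega

theorem false_of_snd_of_dominates {k : ℕ} {x y z : SnarkLoc} (hx : x.Valid k) (hy : y.Valid k)
    (hz : z.Valid k) (h : x.inner = true) (h₃ : y.inner = !x.inner)
    (h₄ : y.kind = x.kind) (h₅ : y.v = x.v) (h₂ : Dominates k z.fst y.fst)
    (e₂ : min (z.dist₂ k) (x.dist₂ k) = min (z.dist₂ k) (y.dist₂ k))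
    (e₃ : min (z.dist₃ k) (x.dist₃ k) = min (z.dist₃ k) (y.dist₃ k)) : False := by
  obtain ⟨t, a, u, v⟩ := x
  obtain ⟨s, b, w, r⟩ := y
  obtain ⟨q, c, m, p⟩ := z
  simp only at h h₃ h₄ h₅
  subst h h₃ h₄ h₅
  simp only [dist₂, dist₃, Valid, Bool.not_true, Bool.false_eq_true, if_true,
    if_false, false_and, true_and, or_false, false_or, reduceCtorEq] at *
  have i₂ : (if c then m - 1 else min (m + 1) k) + q.height ≤ w + s.height := by omega
  have i₃ : (if c then p - 1 else min (p + 1) k) + q.height ≤ r - 1 + s.height := by omega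
  clear e₂ e₃
  cases c <;> cases s <;> cases q <;>
    simp [fst, swapCD, Dominates, ray, height] at * <;> omega

theorem swapCD_swapCD (t : SnarkKind) : t.swapCD.swapCD = t := by cases t <;> rfl

/-- Two vertices that look alike from one column and are dominated, seen from the other one, by a
third vertex are distinguished by `a_2` and `a_{k+1}` together with this vertex. -/
theorem eq_of_fst_of_dominates {k : ℕ} {x y z : SnarkLoc} (hx : x.Valid k) (hy : y.Valid k)
    (hz : z.Valid k) (h : x.fst = y.fst) (h₁ : Dominates k z.snd x.snd)
    (h₂ : Dominates k z.snd y.snd)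
    (e₂ : min (z.dist₂ k) (x.dist₂ k) = min (z.dist₂ k) (y.dist₂ k))
    (e₃ : min (z.dist₃ k) (x.dist₃ k) = min (z.dist₃ k) (y.dist₃ k)) : x = y := by
  refine (eq_or_inner_ne_of_fst hx hy h).resolve_right fun ⟨h₃, h₄, h₅⟩ => ?_
  by_cases hi : x.inner = true
  · exact false_of_fst_of_dominates hx hy hz hi h₃ h₄ h₅ h₂ e₂ e₃
  · exact false_of_fst_of_dominates hy hx hz (by simp [h₃, hi]) (by simp [h₃])
      (by rw [h₄, swapCD_swapCD]) h₅.symm h₁ e₂.symm e₃.symm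

theorem eq_of_snd_of_dominates {k : ℕ} {x y z : SnarkLoc} (hx : x.Valid k) (hy : y.Valid k)
    (hz : z.Valid k) (h : x.snd = y.snd) (h₁ : Dominates k z.fst x.fst)
    (h₂ : Dominates k z.fst y.fst)
    (e₂ : min (z.dist₂ k) (x.dist₂ k) = min (z.dist₂ k) (y.dist₂ k))
    (e₃ : min (z.dist₃ k) (x.dist₃ k) = min (z.dist₃ k) (y.dist₃ k)) : x = y := by
  refine (eq_or_inner_ne_of_snd hx hy h).resolve_right fun ⟨h₃, h₄, h₅⟩ => ?_
  by_cases hi : x.inner = true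
  · exact false_of_snd_of_dominates hx hy hz hi h₃ h₄ h₅ h₂ e₂ e₃
  · exact false_of_snd_of_dominates hy hx hz (by simp [h₃, hi]) (by simp [h₃])
      h₄.symm h₅.symm h₁ e₂.symm e₃.symm

/-- A vertex hidden behind `z` in both views is `z` itself or, when `z` is outer, an inner one with
exactly one of `u`, `v` raised by one. These candidates give different minima at `a_2`. -/
theorem eq_of_dominates {k : ℕ} {x y z : SnarkLoc} (hx : x.Valid k) (hy : y.Valid k)
    (hz : z.Valid k) (h₁ : Dominates k z.fst x.fst) (h₂ : Dominates k z.fst y.fst)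
    (h₃ : Dominates k z.snd x.snd) (h₄ : Dominates k z.snd y.snd)
    (e₂ : min (z.dist₂ k) (x.dist₂ k) = min (z.dist₂ k) (y.dist₂ k)) : x = y := by
  have hx' := eq_or_of_dominates hz hx h₁ h₃
  have hy' := eq_or_of_dominates hz hy h₂ h₄
  clear h₁ h₂ h₃ h₄
  obtain ⟨t, a, u, v⟩ := x
  obtain ⟨s, b, w, r⟩ := y
  obtain ⟨q, c, m, p⟩ := z
  simp only [SnarkLoc.mk.injEq] at *
  rcases hx' with ⟨rfl, rfl, rfl, rfl⟩ | ⟨rfl, rfl, rfl, h1, h2⟩ <;>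
    rcases hy' with ⟨rfl, rfl, rfl, rfl⟩ | ⟨h, rfl, rfl, h3, h4⟩ <;>
    try subst h
  all_goals simp [Valid, dist₂] at * <;> omega

theorem eq_and_eq_of_matches {k : ℕ} {x₁ x₂ y₁ y₂ : SnarkLoc} (hx₁ : x₁.Valid k)
    (hx₂ : x₂.Valid k) (hy₁ : y₁.Valid k) (hy₂ : y₂.Valid k)
    (h₁ : Matches k x₁.fst x₂.fst y₁.fst y₂.fst) (h₂ : Matches k x₁.snd x₂.snd y₁.snd y₂.snd)
    (e₂ : min (x₁.dist₂ k) (x₂.dist₂ k) = min (y₁.dist₂ k) (y₂.dist₂ k))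
    (e₃ : min (x₁.dist₃ k) (x₂.dist₃ k) = min (y₁.dist₃ k) (y₂.dist₃ k)) :
    x₁ = y₁ ∧ x₂ = y₂ := by
  obtain ⟨h₁, h₁'⟩ := h₁
  obtain ⟨h₂, h₂'⟩ := h₂
  obtain rfl := eq_of_fst_snd hx₁ hy₁ h₁ h₂
  refine ⟨rfl, ?_⟩
  rcases h₁' with h₁' | h₁' <;> rcases h₂' with h₂' | h₂'
  · exact eq_of_fst_snd hx₂ hy₂ h₁' h₂'
  · exact eq_of_fst_of_dominates hx₂ hy₂ hx₁ h₁' h₂'.1 h₂'.2 e₂ e₃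
  · exact eq_of_snd_of_dominates hx₂ hy₂ hx₁ h₂' h₁'.1 h₁'.2 e₂ e₃
  · exact eq_of_dominates hx₂ hy₂ hx₁ h₁'.1 h₁'.2 h₂'.1 h₂'.2 e₂

set_option maxHeartbeats 1000000 in
-- Otherwise `y₁` and `y₂` are the reflections of `x₁` in the two columns, both on the other side.
-- If `x₁` is inner, it is strictly nearer to `a_2` than both. If it is outer, `x₂` has to account
-- for the minima at both probes.
theorem eq_or_eq_of_cross {k : ℕ} {x₁ x₂ y₁ y₂ : SnarkLoc} (hx₁ : x₁.Valid k)
    (hx₂ : x₂.Valid k) (hy₁ : y₁.Valid k) (hy₂ : y₂.Valid k)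
    (h₁ : Matches k x₁.fst x₂.fst y₁.fst y₂.fst) (h₂ : Matches k x₁.snd x₂.snd y₂.snd y₁.snd)
    (e₂ : min (x₁.dist₂ k) (x₂.dist₂ k) = min (y₁.dist₂ k) (y₂.dist₂ k))
    (e₃ : min (x₁.dist₃ k) (x₂.dist₃ k) = min (y₁.dist₃ k) (y₂.dist₃ k)) :
    x₁ = y₁ ∨ x₁ = y₂ := by
  obtain ⟨h₁, h₁'⟩ := h₁
  obtain ⟨h₂, h₂'⟩ := h₂
  by_contra! hne
  have h₃ := (eq_or_inner_ne_of_fst hx₁ hy₁ h₁).resolve_left hne.1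
  have h₄ := (eq_or_inner_ne_of_snd hx₁ hy₂ h₂).resolve_left hne.2
  have h₅ : x₂.fst = y₂.fst ∨ Dominates k x₁.fst x₂.fst := h₁'.imp_right And.left
  have h₆ : x₂.snd = y₁.snd ∨ Dominates k x₁.snd x₂.snd := h₂'.imp_right And.left
  clear h₁ h₂ h₁' h₂' hne
  obtain ⟨t, a, u, v⟩ := x₁
  obtain ⟨s, b, w, r⟩ := y₁
  obtain ⟨q, c, m, p⟩ := y₂
  obtain ⟨i, d, f, g⟩ := x₂
  simp only at h₃ h₄
  obtain ⟨rfl, rfl, rfl⟩ := h₃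
  obtain ⟨rfl, rfl, rfl⟩ := h₄
  cases a
  · simp only [dist₂, dist₃, height_swapCD, Valid, Bool.not_false, Bool.false_eq_true, if_true,
      if_false, false_and, true_and, or_false, false_or, reduceCtorEq] at *
    -- Here `y₁` attains the minimum at `a_2` and `y₂` the one at `a_{k+1}`. The two values add up
    -- to `k - 2` plus twice a height: the wrong parity for an inner `x₂`. An outer `x₂` would be
    -- the `a` in the column of `x₁`, against `h₅`.
    have i₂ : (if d then f - 1 else min (f + 1) k) + i.height = w - 1 + q.height := by omega
    have i₃ : (if d then g - 1 else min (g + 1) k) + i.height = p - 1 + q.height := by omega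
    clear e₂ e₃
    cases d <;> cases q <;> cases i <;>
      simp [fst, snd, swapCD, Dominates, ray, height] at * <;> omega
  · clear h₅ h₆ e₃
    simp [Valid, dist₂, height_swapCD] at *
    omega

theorem ray_a (k : ℕ) (t : SnarkKind) (u : ℕ) : ray k .a t u = u + t.height := by
  cases t <;> rfl

theorem fst_add_height_le {k : ℕ} {x y : SnarkLoc} (h : Dominates k x.fst y.fst) :
    x.u + x.kind.height ≤ y.u + y.kind.height := by
  have := h.1
  simp only [ray_a, fst, apply_ite height, height_swapCD, ite_self] at this
  exact this

/-- Otherwise both matchings are of dominance type. Of the twins `x₁`, `y₁` one is inner, and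
dominance keeps the pair without it strictly farther from `a_2`; only the rays from the `a`-leaves
are needed. -/
theorem eq_or_eq_of_opposite {k : ℕ} {x₁ x₂ y₁ y₂ : SnarkLoc} (hx₁ : x₁.Valid k)
    (hx₂ : x₂.Valid k) (hy₁ : y₁.Valid k) (hy₂ : y₂.Valid k)
    (h₁ : Matches k x₁.fst x₂.fst y₁.fst y₂.fst) (h₂ : Matches k x₂.snd x₁.snd y₂.snd y₁.snd)
    (e₂ : min (x₁.dist₂ k) (x₂.dist₂ k) = min (y₁.dist₂ k) (y₂.dist₂ k)) :
    x₁ = y₁ ∨ x₂ = y₂ := by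
  obtain ⟨h₁, h₁'⟩ := h₁
  obtain ⟨h₂, h₂'⟩ := h₂
  by_contra! hne
  have h₃ := (eq_or_inner_ne_of_fst hx₁ hy₁ h₁).resolve_left hne.1
  have h₄ := (eq_or_inner_ne_of_snd hx₂ hy₂ h₂).resolve_left hne.2
  have h₅ := h₁'.resolve_left fun h => hne.2 (eq_of_fst_snd hx₂ hy₂ h h₂)
  have h₆ := h₂'.resolve_left fun h => hne.1 (eq_of_fst_snd hx₁ hy₁ h₁ h)
  have i₁ := fst_add_height_le h₅.1
  have i₂ := fst_add_height_le h₅.2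
  have i₃ := h₆.1.1
  have i₄ := h₆.2.1
  simp only [snd, ray_a] at i₃ i₄
  clear h₁ h₂ h₁' h₂' hne h₅ h₆
  obtain ⟨t, a, u, v⟩ := x₁
  obtain ⟨s, b, w, r⟩ := y₁
  obtain ⟨q, c, m, p⟩ := y₂
  obtain ⟨i, d, f, g⟩ := x₂
  simp only at h₃ h₄
  obtain ⟨rfl, rfl, rfl⟩ := h₃
  obtain ⟨rfl, rfl, rfl⟩ := h₄
  cases a <;> cases d <;> simp [Valid, dist₂, height_swapCD] at * <;> omega

end SnarkLoc

/-! ### Combining the two matchings -/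

namespace SnarkKind

theorem Matches.symm {k : ℕ} {p₁ p₂ q₁ q₂ : SnarkKind × ℕ} (h : Matches k p₁ p₂ q₁ q₂) :
    Matches k q₁ q₂ p₁ p₂ := ⟨h.1.symm, h.2.imp Eq.symm And.symm⟩

theorem Matches.swap_of_eq {k : ℕ} {p₁ p₂ q₁ q₂ : SnarkKind × ℕ} (h : Matches k p₁ p₂ q₁ q₂)
    (h' : p₁ = q₂) : Matches k p₁ p₂ q₂ q₁ := by
  obtain rfl : q₁ = q₂ := h.1.symm.trans h'
  exact h

end SnarkKind

namespace SnarkLoc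
open SnarkKind

theorem eq_or_swap_of_matches {k : ℕ} {x₁ x₂ y₁ y₂ : SnarkLoc} (hx₁ : x₁.Valid k)
    (hx₂ : x₂.Valid k) (hy₁ : y₁.Valid k) (hy₂ : y₂.Valid k)
    (h₁ : Matches k x₁.fst x₂.fst y₁.fst y₂.fst)
    (h₂ : SameRays k x₁.snd x₂.snd y₁.snd y₂.snd)
    (e₂ : min (x₁.dist₂ k) (x₂.dist₂ k) = min (y₁.dist₂ k) (y₂.dist₂ k))
    (e₃ : min (x₁.dist₃ k) (x₂.dist₃ k) = min (y₁.dist₃ k) (y₂.dist₃ k)) :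
    x₁ = y₁ ∧ x₂ = y₂ ∨ x₁ = y₂ ∧ x₂ = y₁ := by
  rcases h₂.matches hx₁.v_le hx₂.v_le hy₁.v_le hy₂.v_le with h | h | h | h
  · exact .inl (eq_and_eq_of_matches hx₁ hx₂ hy₁ hy₂ h₁ h e₂ e₃)
  · rcases eq_or_eq_of_cross hx₁ hx₂ hy₁ hy₂ h₁ h e₂ e₃ with h' | h'
    · exact .inl (eq_and_eq_of_matches hx₁ hx₂ hy₁ hy₂ h₁ (h.swap_of_eq (by rw [h'])) e₂ e₃)
    · exact .inr (eq_and_eq_of_matches hx₁ hx₂ hy₂ hy₁ (h₁.swap_of_eq (by rw [h'])) h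
        (by rw [e₂, min_comm]) (by rw [e₃, min_comm]))
  · rcases eq_or_eq_of_cross hy₁ hy₂ hx₁ hx₂ h₁.symm h.symm e₂.symm e₃.symm with h' | h'
    · exact .inl (eq_and_eq_of_matches hx₁ hx₂ hy₁ hy₂ h₁
        (h.symm.swap_of_eq (by rw [h'])).symm e₂ e₃)
    · obtain ⟨h₃, h₄⟩ := eq_and_eq_of_matches hx₂ hx₁ hy₁ hy₂
        (h₁.symm.swap_of_eq (by rw [h'])).symm h (by rw [← e₂, min_comm]) (by rw [← e₃, min_comm])
      exact .inr ⟨h₄, h₃⟩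
  · rcases eq_or_eq_of_opposite hx₁ hx₂ hy₁ hy₂ h₁ h e₂ with h' | h'
    · exact .inl (eq_and_eq_of_matches hx₁ hx₂ hy₁ hy₂ h₁ ⟨by rw [h'], .inl h.1⟩ e₂ e₃)
    · exact .inl (eq_and_eq_of_matches hx₂ hx₁ hy₂ hy₁ ⟨by rw [h'], .inl h₁.1⟩ h
        (by rw [min_comm, e₂, min_comm]) (by rw [min_comm, e₃, min_comm])).symm

/-- Two pairs of locations with the same distances from the eight landmarks are equal. -/
theorem eq_or_swap {k : ℕ} {x₁ x₂ y₁ y₂ : SnarkLoc} (hx₁ : x₁.Valid k)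
    (hx₂ : x₂.Valid k) (hy₁ : y₁.Valid k) (hy₂ : y₂.Valid k)
    (h₁ : SameRays k x₁.fst x₂.fst y₁.fst y₂.fst)
    (h₂ : SameRays k x₁.snd x₂.snd y₁.snd y₂.snd)
    (e₂ : min (x₁.dist₂ k) (x₂.dist₂ k) = min (y₁.dist₂ k) (y₂.dist₂ k))
    (e₃ : min (x₁.dist₃ k) (x₂.dist₃ k) = min (y₁.dist₃ k) (y₂.dist₃ k)) :
    x₁ = y₁ ∧ x₂ = y₂ ∨ x₁ = y₂ ∧ x₂ = y₁ := by
  have e₂' := (min_comm _ _).trans e₂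
  have e₃' := (min_comm _ _).trans e₃
  rcases h₁.matches hx₁.u_le hx₂.u_le hy₁.u_le hy₂.u_le with h | h | h | h
  · exact eq_or_swap_of_matches hx₁ hx₂ hy₁ hy₂ h h₂ e₂ e₃
  · exact (eq_or_swap_of_matches hx₁ hx₂ hy₂ hy₁ h h₂.swap_right (e₂.trans (min_comm _ _))
      (e₃.trans (min_comm _ _))).symm
  · exact (eq_or_swap_of_matches hx₂ hx₁ hy₁ hy₂ h h₂.swap_left e₂' e₃').symm.imp And.symm And.symm
  · exact (eq_or_swap_of_matches hx₂ hx₁ hy₂ hy₁ h h₂.swap_left.swap_right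
      (e₂'.trans (min_comm _ _)) (e₃'.trans (min_comm _ _))).imp And.symm And.symm

end SnarkLoc

/-! ### Distances in the flower snark -/

namespace SimpleGraph

/-- A function that vanishes only at `s`, changes by at most one along every edge and decreases
along some edge at every other vertex is the distance from `s`. -/
theorem edist_eq_of_descent {V : Type*} {G : SimpleGraph V} {s : V} (f : V → ℕ) (hs : f s = 0)
    (hlip : ∀ v w, G.Adj v w → f w ≤ f v + 1)
    (hdesc : ∀ v, v = s ∨ ∃ w, G.Adj w v ∧ f w + 1 = f v) (v : V) :
    G.edist s v = f v := by
  apply le_antisymm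
  · have : ∀ m v, f v = m → ∃ p : G.Walk s v, p.length = m := by
      intro m
      induction m with
      | zero =>
        intro v hv
        obtain rfl | ⟨w, -, hw⟩ := hdesc v
        · exact ⟨.nil, rfl⟩
        · omega
      | succ m ih =>
        intro v hv
        obtain rfl | ⟨w, hwv, hw⟩ := hdesc v
        · omega
        · obtain ⟨p, hp⟩ := ih w (by omega)
          exact ⟨p.concat hwv, by rw [Walk.length_concat, hp]⟩
    obtain ⟨p, hp⟩ := this _ v rfl
    exact hp ▸ edist_le p
  · refine le_iInf fun p => ?_
    have : ∀ {a b : V} (p : G.Walk a b), f b ≤ f a + p.length := by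
      intro a b p
      induction p with
      | nil => simp
      | cons h p ih =>
        have := hlip _ _ h
        rw [Walk.length_cons]
        omega
    have := this p
    rw [hs, zero_add] at this
    exact_mod_cast this

end SimpleGraph

namespace SnarkVertex
open SnarkKind

/-- The distance in `J_n` between the vertex of kind `e ≠ b` in column `p` and the vertex `w`. -/
def distFrom (n : ℕ) (e : SnarkKind) (p : ℕ) (t : SnarkKind) (j : ℕ) : ℕ :=
  let D := (j - p) + (p - j)
  match e, t with
  | .a, t => min D (n - D) + t.height
  | .b, _ => 0
  | .c, .a => min D (n - D) + 2
  | .c, .b => min D (n - D) + 1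
  -- The way across the twist ends on the other strand; returning through a star costs the two extra
  -- edges.
  | .c, .c => min D (n - D + 2)
  | .c, .d => min (D + 2) (n - D)
  | .d, .a => min D (n - D) + 2
  | .d, .b => min D (n - D) + 1
  | .d, .c => min (D + 2) (n - D)
  | .d, .d => min D (n - D + 2)

theorem distFrom_edge {n : ℕ} {e : SnarkKind} {p : ℕ} (hp : p < n) {v w : SnarkVertex n}
    (h : SnarkEdge n v w) :
    distFrom n e p v.1 v.2 ≤ distFrom n e p w.1 w.2 + 1 ∧
      distFrom n e p w.1 w.2 ≤ distFrom n e p v.1 v.2 + 1 := by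
  cases h with
  | ba i => cases e <;> simp only [distFrom, height] <;> omega
  | bc i => have := i.2; cases e <;> simp only [distFrom, height] <;> omega
  | bd i => have := i.2; cases e <;> simp only [distFrom, height] <;> omega
  | aa i j h => have := j.2; cases e <;> simp only [distFrom, height] <;> omega
  | aa' i j hi hj => cases e <;> simp only [distFrom, height] <;> omega
  | cc i j h => have := j.2; cases e <;> simp only [distFrom, height] <;> omega
  | dd i j h => have := j.2; cases e <;> simp only [distFrom, height] <;> omega
  | cd i j hi hj => cases e <;> simp only [distFrom, height] <;> omega
  | dc i j hi hj => cases e <;> simp only [distFrom, height] <;> omega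

theorem adj_of_edge {n : ℕ} {v w : SnarkVertex n} (h : SnarkEdge n v w) (hne : v ≠ w) :
    (flowerSnark n).Adj v w ∧ (flowerSnark n).Adj w v :=
  ⟨(SimpleGraph.fromRel_adj _ _ _).2 ⟨hne, .inl h⟩,
    (SimpleGraph.fromRel_adj _ _ _).2 ⟨hne.symm, .inr h⟩⟩

/-- A neighbour of `v` in the snark, given by its kind and column. -/
def Step (n : ℕ) (t : SnarkKind) (j : ℕ) (s : SnarkKind) (i : ℕ) : Prop :=
  ∃ (hi : i < n) (hj : j < n), (flowerSnark n).Adj (s, ⟨i, hi⟩) (t, ⟨j, hj⟩)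

section
variable {n i j : ℕ}

theorem step_spoke (h : j < n) {t : SnarkKind} (ht : t ≠ .b) : Step n .b j t j ∧ Step n t j .b j := by
  have : SnarkEdge n (.b, ⟨j, h⟩) (t, ⟨j, h⟩) := by
    cases t
    exacts [.ba _, absurd rfl ht, .bc _, .bd _]
  have := adj_of_edge this (by simpa using ht.symm)
  exact ⟨⟨h, h, this.2⟩, ⟨h, h, this.1⟩⟩

theorem step_succ (h : j + 1 < n) {t : SnarkKind} (ht : t ≠ .b) :
    Step n t j t (j + 1) ∧ Step n t (j + 1) t j := by
  have : SnarkEdge n (t, ⟨j, by omega⟩) (t, ⟨j + 1, h⟩) := by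
    cases t
    exacts [.aa _ _ rfl, absurd rfl ht, .cc _ _ rfl, .dd _ _ rfl]
  have := adj_of_edge this (by simp)
  exact ⟨⟨h, by omega, this.2⟩, ⟨by omega, h, this.1⟩⟩

theorem step_last (h : 1 < n) {t : SnarkKind} (ht : t ≠ .b) :
    Step n t (n - 1) t.swapCD 0 ∧ Step n t 0 t.swapCD (n - 1) := by
  have key : ∀ t : SnarkKind, t ≠ .b →
      SnarkEdge n (t, ⟨n - 1, by omega⟩) (t.swapCD, ⟨0, by omega⟩) := by
    intro t ht
    have h1 : n - 1 + 1 = n := by omega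
    cases t
    exacts [.aa' _ _ h1 rfl, absurd rfl ht, .cd _ _ h1 rfl, .dc _ _ h1 rfl]
  have h1 := adj_of_edge (key t ht) (by simp; omega)
  have h2 := adj_of_edge (key t.swapCD (by cases t <;> simp [swapCD] at *)) (by simp; omega)
  rw [SnarkLoc.swapCD_swapCD] at h2
  exact ⟨⟨by omega, by omega, h1.2⟩, ⟨by omega, by omega, h2.1⟩⟩

theorem exists_step_toward {p : ℕ} (hj : j < n) (hp : p < n) (hjp : j ≠ p) {t : SnarkKind}
    (ht : t ≠ .b) : ∃ i, Step n t j t i ∧ (i - p) + (p - i) + 1 = (j - p) + (p - j) := by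
  rcases lt_or_gt_of_ne hjp with h | h
  · exact ⟨j + 1, (step_succ (by omega) ht).1, by omega⟩
  · obtain ⟨j, rfl⟩ := Nat.exists_eq_succ_of_ne_zero (Nat.ne_zero_of_lt h)
    exact ⟨j, (step_succ hj ht).2, by omega⟩

theorem exists_step_away {p : ℕ} (hn : 1 < n) (hj : j < n) (hp : p < n) (hjp : j ≠ p)
    {t : SnarkKind} (ht : t ≠ .b) :
    (∃ i, Step n t j t i ∧ (i - p) + (p - i) = (j - p) + (p - j) + 1) ∨
      ∃ i, Step n t j t.swapCD i ∧ (i - p) + (p - i) + ((j - p) + (p - j)) + 1 = n := by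
  rcases lt_or_gt_of_ne hjp with h | h
  · rcases j with _ | j
    · exact .inr ⟨n - 1, (step_last hn ht).2, by omega⟩
    · exact .inl ⟨j, (step_succ hj ht).2, by omega⟩
  · by_cases hl : j + 1 < n
    · exact .inl ⟨j + 1, (step_succ hl ht).1, by omega⟩
    · obtain rfl : j = n - 1 := by omega
      exact .inr ⟨0, (step_last hn ht).1, by omega⟩

end

/-- From `b`, descend to the leaf on the strand leading to the target the shorter way. From a leaf,
take the spoke to `b` if that descends; otherwise move along the strand, towards column `p` or away
from it. -/
theorem exists_step {n : ℕ} {e : SnarkKind} {p : ℕ} (he : e ≠ .b) (hn : 3 ≤ n) (hp : p < n)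
    (t : SnarkKind) (j : ℕ) (hj : j < n) :
    (t = e ∧ j = p) ∨ ∃ s i, Step n t j s i ∧ distFrom n e p s i + 1 = distFrom n e p t j := by
  by_cases ht : t = .b
  · subst ht
    by_cases hd : (j - p) + (p - j) ≤ n - ((j - p) + (p - j)) ∨ e = .a
    · exact .inr ⟨e, j, (step_spoke hj he).1, by
        cases e <;> simp [distFrom, height] at * <;> omega⟩
    · exact .inr ⟨e.swapCD, j, (step_spoke hj (by cases e <;> simp [swapCD] at *)).1, by
        cases e <;> simp [distFrom, swapCD] at * <;> omega⟩
  by_cases hb : distFrom n e p .b j + 1 = distFrom n e p t j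
  · exact .inr ⟨.b, j, (step_spoke hj ht).2, hb⟩
  by_cases hjp : j = p
  · subst hjp
    left
    cases e <;> cases t <;> simp [distFrom, height] at * <;> omega
  right
  by_cases hd : (e = .a ∧ (j - p) + (p - j) ≤ n - ((j - p) + (p - j))) ∨ (t = e ∧ e ≠ .a)
  · obtain ⟨i, hi, h⟩ := exists_step_toward hj hp hjp ht
    refine ⟨t, i, hi, ?_⟩
    cases e <;> cases t <;> simp [distFrom, height] at * <;> omega
  · rcases exists_step_away (by omega) hj hp hjp ht with ⟨i, hi, h⟩ | ⟨i, hi, h⟩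
    · refine ⟨t, i, hi, ?_⟩
      clear hi
      cases e <;> cases t <;> simp [distFrom, height] at * <;> omega
    · refine ⟨_, i, hi, ?_⟩
      clear hi
      cases e <;> cases t <;> simp [distFrom, height, swapCD] at * <;> omega

theorem edist_eq {n : ℕ} {e : SnarkKind} {p : ℕ} (he : e ≠ .b) (hn : 3 ≤ n) (hp : p < n)
    (v : SnarkVertex n) :
    (flowerSnark n).edist (e, ⟨p, hp⟩) v = distFrom n e p v.1 v.2 := by
  refine SimpleGraph.edist_eq_of_descent (fun v => distFrom n e p v.1 v.2) ?_ ?_ ?_ v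
  · cases e <;> simp [distFrom, height] at *
  · intro v w h
    rw [flowerSnark, SimpleGraph.fromRel_adj] at h
    rcases h.2 with h | h
    exacts [(distFrom_edge hp h).2, (distFrom_edge hp h).1]
  · rintro ⟨t, j, hj⟩
    rcases exists_step he hn hp t j hj with ⟨rfl, rfl⟩ | ⟨s, i, ⟨hi, _, h⟩, h'⟩
    · exact .inl rfl
    · exact .inr ⟨(s, ⟨i, hi⟩), h, h'⟩

end SnarkVertex

/-! ### Coordinates of vertices and the final assembly -/

namespace SnarkVertex
open SnarkKind

/-- The location of the vertex of kind `t` in column `j`, counted from `0`, of `J_n`,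
`n = 2 * k + 1`. -/
def loc (k : ℕ) (t : SnarkKind) (j : ℕ) : SnarkLoc where
  -- Kinds are named as seen from column `k + 2`; column `1` is the only one whose shorter way from
  -- there crosses the twist.
  kind := if j = 0 then t.swapCD else t
  inner := decide (1 ≤ j ∧ j ≤ k)
  u := if j ≤ k then j else 2 * k + 1 - j
  v := if j = 0 then k else if j ≤ k then k + 1 - j else j - (k + 1)

theorem loc_valid {k : ℕ} (t : SnarkKind) {j : ℕ} (hj : j < 2 * k + 1) : (loc k t j).Valid k := by
  simp only [SnarkLoc.Valid, loc, decide_eq_true_eq, decide_eq_false_iff_not]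
  split_ifs <;> omega

theorem loc_injective {k : ℕ} {t s : SnarkKind} {i j : ℕ} (hi : i < 2 * k + 1)
    (hj : j < 2 * k + 1) (h : loc k t i = loc k s j) : t = s ∧ i = j := by
  simp only [loc, SnarkLoc.mk.injEq, decide_eq_decide] at h
  obtain ⟨h₁, h₂, h₃, h₄⟩ := h
  have hij : i = j := by
    clear h₁
    split_ifs at h₃ h₄ <;> omega
  subst hij
  refine ⟨?_, rfl⟩
  split_ifs at h₁
  · rw [← SnarkLoc.swapCD_swapCD t, h₁, SnarkLoc.swapCD_swapCD]
  · exact h₁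

theorem distFrom_zero {k : ℕ} {e : SnarkKind} (he : e ≠ .b) (t : SnarkKind) {j : ℕ}
    (hj : j < 2 * k + 1) :
    distFrom (2 * k + 1) e 0 t j = ray k e (loc k t j).fst.1 (loc k t j).fst.2 := by
  rcases Nat.eq_zero_or_pos j with rfl | h0
  · cases e <;> cases t <;> simp [distFrom, loc, SnarkLoc.fst, swapCD, ray, height] at he ⊢
  · have h1 : 1 ≤ j := h0
    by_cases hk : j ≤ k <;> cases e <;> cases t <;>
      simp [distFrom, loc, SnarkLoc.fst, swapCD, ray, height, h0.ne', hk, h1] at he ⊢ <;> omega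

theorem distFrom_succ {k : ℕ} {e : SnarkKind} (he : e ≠ .b) (t : SnarkKind) {j : ℕ}
    (hj : j < 2 * k + 1) :
    distFrom (2 * k + 1) e (k + 1) t j = ray k e (loc k t j).snd.1 (loc k t j).snd.2 := by
  rcases Nat.eq_zero_or_pos j with rfl | h0
  · cases e <;> cases t <;>
      simp [distFrom, loc, SnarkLoc.snd, swapCD, ray, height] at he ⊢ <;> omega
  · have h1 : 1 ≤ j := h0
    by_cases hk : j ≤ k <;> cases e <;> cases t <;>
      simp [distFrom, loc, SnarkLoc.snd, ray, height, h0.ne', hk, h1] at he ⊢ <;> omega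

theorem distFrom_one {k : ℕ} (hk : 1 ≤ k) (t : SnarkKind) {j : ℕ} (hj : j < 2 * k + 1) :
    distFrom (2 * k + 1) .a 1 t j = (loc k t j).dist₂ k := by
  simp only [distFrom, SnarkLoc.dist₂, loc, decide_eq_true_eq, apply_ite height,
    SnarkLoc.height_swapCD, ite_self]
  split_ifs <;> omega

theorem distFrom_self {k : ℕ} (hk : 1 ≤ k) (t : SnarkKind) {j : ℕ} (hj : j < 2 * k + 1) :
    distFrom (2 * k + 1) .a k t j = (loc k t j).dist₃ k := by
  simp only [distFrom, SnarkLoc.dist₃, loc, decide_eq_true_eq, apply_ite height,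
    SnarkLoc.height_swapCD, ite_self]
  split_ifs <;> omega

end SnarkVertex

/-- The two elements may coincide, so singletons need no separate treatment. -/
theorem Finset.exists_eq_pair_of_card_le_two {α : Type*} [DecidableEq α] {X : Finset α}
    (h : X.Nonempty) (h' : X.card ≤ 2) : ∃ x y, X = {x, y} := by
  have := h.card_pos
  obtain h1 | h2 : X.card = 1 ∨ X.card = 2 := by omega
  · obtain ⟨x, rfl⟩ := Finset.card_eq_one.1 h1
    exact ⟨x, x, by simp⟩
  · obtain ⟨x, y, -, rfl⟩ := Finset.card_eq_two.1 h2
    exact ⟨x, y, rfl⟩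

theorem isResolvingSet_snarkSet (n k : ℕ) (hk : n = 2 * k + 1) (hn : 7 ≤ n) :
    IsResolvingSet (flowerSnark n) 2 (snarkSet n k hk hn) := by
  refine ⟨⟨(.a, ⟨0, by omega⟩), by simp [snarkSet]⟩, ?_⟩
  intro X Y hX hY hX' hY' hne harr
  obtain ⟨⟨t₁, i₁⟩, ⟨t₂, i₂⟩, rfl⟩ := Finset.exists_eq_pair_of_card_le_two hX hX'
  obtain ⟨⟨s₁, j₁⟩, ⟨s₂, j₂⟩, rfl⟩ := Finset.exists_eq_pair_of_card_le_two hY hY'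
  have key : ∀ (e : SnarkKind) (p : ℕ) (hp : p < n), e ≠ .b → (e, ⟨p, hp⟩) ∈ snarkSet n k hk hn →
      min (SnarkVertex.distFrom n e p t₁ i₁) (SnarkVertex.distFrom n e p t₂ i₂) =
        min (SnarkVertex.distFrom n e p s₁ j₁) (SnarkVertex.distFrom n e p s₂ j₂) := by
    intro e p hp he hs
    have := congrFun harr ⟨_, hs⟩
    simp only [distArray, Finset.inf_insert, Finset.inf_singleton,
      SnarkVertex.edist_eq he (by omega : 3 ≤ n) hp] at this
    exact Nat.cast_injective (R := ℕ∞) (by simpa only [(Nat.mono_cast (α := ℕ∞)).map_min] using this)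
  subst hk
  have mem : ∀ e, e ≠ SnarkKind.b →
      (e, ⟨0, by omega⟩) ∈ snarkSet _ k rfl hn ∧ (e, ⟨k + 1, by omega⟩) ∈ snarkSet _ k rfl hn := by
    intro e he
    cases e <;> simp [snarkSet] at he ⊢
  have h₃ := key .a 1 (by omega) (by decide) (by simp [snarkSet])
  have h₄ := key .a k (by omega) (by decide) (by simp [snarkSet])
  have hk : 1 ≤ k := by omega
  simp only [SnarkVertex.distFrom_one hk _ (Fin.is_lt _)] at h₃
  simp only [SnarkVertex.distFrom_self hk _ (Fin.is_lt _)] at h₄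
  have := SnarkLoc.eq_or_swap (SnarkVertex.loc_valid t₁ i₁.2) (SnarkVertex.loc_valid t₂ i₂.2)
    (SnarkVertex.loc_valid s₁ j₁.2) (SnarkVertex.loc_valid s₂ j₂.2)
    (fun e he => by
      simpa only [SnarkVertex.distFrom_zero he _ (Fin.is_lt _)] using
        key e 0 (by omega) he (mem e he).1)
    (fun e he => by
      simpa only [SnarkVertex.distFrom_succ he _ (Fin.is_lt _)] using
        key e (k + 1) (by omega) he (mem e he).2) h₃ h₄
  have inj : ∀ {t s : SnarkKind} {i j : Fin (2 * k + 1)},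
      SnarkVertex.loc k t i = SnarkVertex.loc k s j → ((t, i) : SnarkVertex _) = (s, j) :=
    fun h => by
      obtain ⟨rfl, h'⟩ := SnarkVertex.loc_injective (Fin.is_lt _) (Fin.is_lt _) h
      exact Prod.ext rfl (Fin.ext h')
  rcases this with ⟨h, h'⟩ | ⟨h, h'⟩
  · exact hne (by rw [inj h, inj h'])
  · exact hne (by rw [inj h, inj h', Finset.pair_comm])

theorem card_snarkSet (n k : ℕ) (hk : n = 2 * k + 1) (hn : 7 ≤ n) :
    (snarkSet n k hk hn).card = 8 := by
  have hk : k ≠ 0 ∧ k ≠ 1 := by omega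
  unfold snarkSet
  repeat rw [Finset.card_insert_of_notMem (by simp; try omega)]
  rw [Finset.card_singleton]

theorem mainTheorem4 (n k : ℕ) (hk : n = 2 * k + 1) (hn : 7 ≤ n) :
    IsResolvingSet (flowerSnark n) 2 (snarkSet n k hk hn) ∧
      (snarkSet n k hk hn).card = 8 ∧
      metricDim (flowerSnark n) 2 ≤ 8 := by
  have h := isResolvingSet_snarkSet n k hk hn
  have hc := card_snarkSet n k hk hn
  refine ⟨h, hc, (iInf₂_le _ h).trans ?_⟩
  rw [hc]
  rfl
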